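/- Let $(W,S)$ be a Coxeter system ($S$ and $W$ may be infinite), with length function $\ell$. Let $\bar S$ be the set of classes of elements of $S$ under conjugacy in $W$, and $\bar s\in\bar S$ the class of $s\in S$. Let $\Gamma$ be an abelian group with a total order compatible with addition, and let $\mathbb Z[\Gamma]=\bigoplus_{\gamma\in\Gamma}\mathbb Z e^\gamma$ be its group ring, with the involution $\overline{e^\gamma}=e^{-\gamma}$. For a map $\varphi:\bar S\to\Gamma$, write $\varphi(s)=\varphi(\bar s)$ and let $\mathcal H(W,S,\varphi)$ be the Hecke algebra: the free $\mathbb Z[\Gamma]$-module with basis $(T_w^\varphi)_{w\in W}$ and the unique associative $\mathbb Z[\Gamma]$-bilinear multiplication such that $T_wT_{w'}=T_{ww'}$ if $\ell(ww')=\ell(w)+\ell(w')$ and $(T_s-e^{\varphi(s)})(T_s+e^{-\varphi(s)})=0$ for $s\in S$. The bar involution is the additive map $\overline{\sum_w a_wT_w}=\sum_w\overline{a_w}\,T_{w^{-1}}^{-1}$. Let $\mathcal H_{<0}(W,S,\varphi)=\bigoplus_{w}\mathbb Z[\Gamma_{<0}]\,T_w$, where $\mathbb Z[\Gamma_{<0}]=\bigoplus_{\gamma<0}\mathbb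 Z e^\gamma$, and let $C_w^\varphi$ be the unique element with $\overline{C_w^\varphi}=C_w^\varphi$ and $C_w^\varphi\equiv T_w^\varphi \bmod \mathcal H_{<0}(W,S,\varphi)$; the $C_w^\varphi$ form a $\mathbb Z[\Gamma]$-basis. For $x,y\in W$ write $x\leftarrow_L y$ (respectively $x\leftarrow_R y$, $x\leftarrow_{LR}y$) if there is $h\in\mathcal H(W,S,\varphi)$ such that $C_x^\varphi$ occurs with non-zero coefficient in $hC_y^\varphi$ (respectively in $C_y^\varphi h$, in $hC_y^\varphi$ or $C_y^\varphi h$). For $?\in\{L,R,LR\}$ let $\leq_?^\varphi$ be the transitive closure of $\leftarrow_?$ (a preorder), and let $\sim_?^\varphi$ be the associated equivalence relation, whose classes are the left, right and two-sided cells. Let $S=S_+\,\dot\cup\,S_-$ be a partition (either part may be empty) such that no element of $S_+$ is conjugate in $W$ to an element of $S_-$. Let $\varphi':\bar S\to\Gamma$ be given by $\varphi'(\bar s)=\varphi(\bar s)$ if $s\in S_+$ and $\varphi'(\bar s)=-\varphi(\bar s)$ if $s\in S_-$. Let $\ell_-(w)$ be the number of occurrences of elements of $S_-$ in a reduced expression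 of $w$ (it does not depend on the expression), and let $\theta:\mathcal H(W,S,\varphi)\to\mathcal H(W,S,\varphi')$ be the $\mathbb Z[\Gamma]$-linear map with $\theta(T_w^\varphi)=(-1)^{\ell_-(w)}T_w^{\varphi'}$ for all $w\in W$. Then: 1. $\theta$ is an isomorphism of $\mathbb Z[\Gamma]$-algebras. 2. $\theta$ maps $\mathcal H_{<0}(W,S,\varphi)$ onto $\mathcal H_{<0}(W,S,\varphi')$. 3. $\theta(\overline h)=\overline{\theta(h)}$ for all $h\in\mathcal H(W,S,\varphi)$. 4. $\theta(C_w^\varphi)=(-1)^{\ell_-(w)}C_w^{\varphi'}$ for all $w\in W$. 5. For each $?\in\{L,R,LR\}$, the relations $\leq_?^\varphi$ and $\leq_?^{\varphi'}$ on $W$ coincide, and so do $\sim_?^\varphi$ and $\sim_?^{\varphi'}$. -/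

import Mathlib

namespace KazhdanLusztig

section Coxeter

variable {B W : Type*} [Group W] {M : CoxeterMatrix B} (cs : CoxeterSystem M W)

/-! ### The exchange condition -/

open Classical in
/-- The map `(t, e) ↦ (s t s, e + [t = s])` on pairs of a group element and a sign. -/
noncomputable def signedConj (i : B) : Function.End (W × ZMod 2) :=
  fun p => (cs.simple i * p.1 * cs.simple i, p.2 + if p.1 = cs.simple i then 1 else 0)

open Classical in
theorem signedConj_apply (i : B) (t : W) (e : ZMod 2) :
    signedConj cs i (t, e) =
      (cs.simple i * t * cs.simple i, e + if t = cs.simple i then 1 else 0) := rfl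

open Classical in
theorem signedConj_pow (i j : B) (k : ℕ) (t : W) (e : ZMod 2) :
    ((signedConj cs i * signedConj cs j) ^ k) (t, e) =
      ((cs.simple i * cs.simple j) ^ k * t * ((cs.simple i * cs.simple j) ^ k)⁻¹,
        e + ∑ l ∈ Finset.range (2 * k),
          if t = cs.simple j * (cs.simple i * cs.simple j) ^ l then 1 else 0) := by
  have hsj : cs.simple j * cs.simple j = 1 := cs.simple_mul_simple_self j
  have hsi : cs.simple i * cs.simple i = 1 := cs.simple_mul_simple_self i
  obtain ⟨p, hpd⟩ : ∃ p, p = cs.simple i * cs.simple j := ⟨_, rfl⟩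
  have hsp : p * cs.simple j * p = cs.simple j := by
    rw [hpd]; simp [mul_assoc]
  have hp : ∀ l : ℕ, p ^ l * cs.simple j * p ^ l = cs.simple j := by
    intro l
    induction l with
    | zero => simp
    | succ l ih =>
      calc p ^ (l + 1) * cs.simple j * p ^ (l + 1)
          = p ^ l * (p * cs.simple j * p) * p ^ l := by
            rw [pow_succ]; nth_rw 2 [← pow_succ]; rw [pow_succ']; simp only [mul_assoc]
        _ = _ := by rw [hsp, ih]
  have hp' : ∀ l : ℕ, (p ^ l)⁻¹ * cs.simple j = cs.simple j * p ^ l := by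
    intro l
    rw [inv_mul_eq_iff_eq_mul, ← mul_assoc, hp]
  rw [← hpd]
  induction k with
  | zero => simp [Function.End.one_def]
  | succ k ih =>
    have key : (signedConj cs i * signedConj cs j) ^ (k + 1) =
        signedConj cs i * (signedConj cs j * (signedConj cs i * signedConj cs j) ^ k) := by
      rw [pow_succ', mul_assoc]
    rw [key]
    change signedConj cs i (signedConj cs j
      (((signedConj cs i * signedConj cs j) ^ k) (t, e))) = _
    rw [ih, signedConj_apply, signedConj_apply, show 2 * (k + 1) = 2 * k + 1 + 1 by ring, Finset.sum_range_succ,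
      Finset.sum_range_succ]
    have h1 : (p ^ k * t * (p ^ k)⁻¹ = cs.simple j) ↔ (t = cs.simple j * p ^ (2 * k)) := by
      rw [mul_inv_eq_iff_eq_mul, ← eq_inv_mul_iff_mul_eq, ← mul_assoc, hp', mul_assoc, ← pow_add,
        two_mul]
    have h2 : (cs.simple j * (p ^ k * t * (p ^ k)⁻¹) * cs.simple j = cs.simple i) ↔
        (t = cs.simple j * p ^ (2 * k + 1)) := by
      have : cs.simple i = cs.simple j * (cs.simple j * p) * cs.simple j := by
        rw [hpd]; simp [mul_assoc]
      rw [this, mul_left_inj, mul_right_inj, mul_inv_eq_iff_eq_mul, ← eq_inv_mul_iff_mul_eq,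
        ← mul_assoc, ← mul_assoc, hp', mul_assoc, mul_assoc, ← pow_succ', ← pow_add]
      ring_nf
    ext1
    · rw [pow_succ', hpd]
      simp only [mul_inv_rev, CoxeterSystem.inv_simple, mul_assoc]
    · rw [if_congr h1 rfl rfl, if_congr h2 rfl rfl]
      ring

theorem isLiftable_signedConj : M.IsLiftable (signedConj cs) := by
  classical
  intro i j
  funext ⟨t, e⟩
  rw [signedConj_pow, cs.simple_mul_simple_pow, two_mul, Finset.sum_range_add]
  have : ∀ l, (cs.simple i * cs.simple j) ^ (M i j + l) = (cs.simple i * cs.simple j) ^ l := by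
    intro l; rw [pow_add, cs.simple_mul_simple_pow, one_mul]
  simp only [this, CharTwo.add_self_eq_zero]
  simp [Function.End.one_def]

open Classical in
theorem lift_signedConj (ω : List B) (t : W) (e : ZMod 2) :
    cs.lift ⟨signedConj cs, isLiftable_signedConj cs⟩ (cs.wordProd ω) (t, e) =
      (cs.wordProd ω * t * (cs.wordProd ω)⁻¹, e + ((cs.rightInvSeq ω).count t : ZMod 2)) := by
  induction ω with
  | nil => simp [Function.End.one_def]
  | cons i ω ih =>
    rw [cs.wordProd_cons, map_mul]
    change cs.lift ⟨signedConj cs, isLiftable_signedConj cs⟩ (cs.simple i)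
      (cs.lift ⟨signedConj cs, isLiftable_signedConj cs⟩ (cs.wordProd ω) (t, e)) = _
    rw [ih, cs.lift_apply_simple]
    have h : (cs.wordProd ω * t * (cs.wordProd ω)⁻¹ = cs.simple i) ↔
        ((cs.wordProd ω)⁻¹ * cs.simple i * cs.wordProd ω = t) := by
      constructor
      · rintro h; rw [← h]; group
      · rintro rfl; group
    ext1
    · simp [signedConj, mul_assoc]
    · simp only [signedConj, CoxeterSystem.rightInvSeq, List.count_cons, beq_iff_eq]
      rw [if_congr h rfl rfl]
      push_cast
      ring

/-- Exchange condition on the right: a right descent of a reduced word is realised by deleting a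
letter. -/
theorem exists_eraseIdx_of_rightDescent {ω : List B} {i : B}
    (h : cs.length (cs.wordProd ω * cs.simple i) < cs.length (cs.wordProd ω)) :
    ∃ j, ∃ hj : j < ω.length,
      cs.wordProd ω * cs.simple i = cs.wordProd (ω.eraseIdx j) ∧
      IsConj (cs.simple i) (cs.simple ω[j]) := by
  classical
  obtain ⟨ω', hω', hw'⟩ := cs.exists_isReduced (cs.wordProd ω * cs.simple i)
  have hw : cs.wordProd ω = cs.wordProd (ω'.concat i) := by
    rw [cs.wordProd_concat, ← hw']; simp
  have hnot : cs.simple i ∉ cs.rightInvSeq ω' := by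
    intro hmem
    have := (cs.isRightInversion_of_mem_rightInvSeq hω' hmem).2
    rw [← hw'] at this
    simp only [CoxeterSystem.simple_mul_simple_cancel_right] at this
    omega
  have hnot' : cs.simple i ∉ List.map (MulAut.conj (cs.simple i)) (cs.rightInvSeq ω') := by
    intro hmem
    obtain ⟨x, hx, hxe⟩ := List.mem_map.1 hmem
    apply hnot
    have : x = cs.simple i := by
      rw [MulAut.conj_apply, mul_inv_eq_iff_eq_mul, mul_right_inj] at hxe
      exact hxe
    rwa [← this]
  have h1 := lift_signedConj cs ω (cs.simple i) 0
  rw [hw, lift_signedConj cs (ω'.concat i) (cs.simple i) 0, cs.rightInvSeq_concat] at h1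
  have h2 := congrArg Prod.snd h1
  simp only [List.concat_eq_append, List.count_append, List.count_eq_zero_of_not_mem hnot',
    List.count_singleton_self] at h2
  have hmem : cs.simple i ∈ cs.rightInvSeq ω := by
    by_contra hcon
    rw [List.count_eq_zero_of_not_mem hcon] at h2
    simp at h2
  obtain ⟨j, hj, hje⟩ := List.mem_iff_getElem.1 hmem
  have hj' : j < ω.length := by simpa using hj
  refine ⟨j, hj', ?_, ?_⟩
  · rw [← cs.wordProd_mul_getD_rightInvSeq, List.getD_eq_getElem _ _ hj, hje]
  · rw [cs.getElem_rightInvSeq ω j hj'] at hje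
    rw [isConj_iff]
    refine ⟨cs.wordProd (ω.drop (j + 1)), ?_⟩
    rw [← hje]
    simp [List.getElem?_eq_getElem hj', mul_assoc]

theorem simple_mul_eq_mul_simple {w : W} {i j : B}
    (h1 : cs.length w < cs.length (cs.simple i * w))
    (h2 : cs.length (cs.simple i * w * cs.simple j) < cs.length (cs.simple i * w))
    (h3 : cs.length w < cs.length (w * cs.simple j)) :
    cs.simple i * w = w * cs.simple j := by
  obtain ⟨ω, hω, rfl⟩ := cs.exists_isReduced w
  rw [← cs.wordProd_cons] at h2
  obtain ⟨k, hk, hke, -⟩ := exists_eraseIdx_of_rightDescent cs h2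
  cases k with
  | zero =>
    rw [cs.wordProd_cons] at hke
    simp only [List.eraseIdx_cons_zero] at hke
    nth_rw 2 [← hke]
    simp
  | succ k =>
    exfalso
    rw [cs.wordProd_cons, List.eraseIdx_cons_succ, cs.wordProd_cons, mul_assoc, mul_right_inj] at hke
    rw [hke, hω.eq] at h3
    have := cs.length_wordProd_le (ω.eraseIdx k)
    have := List.length_eraseIdx_le ω k
    omega

/-! ### Classes of simple reflections and weighted lengths -/

/-- Conjugacy in `W` of the simple reflections, as an equivalence relation on their indices. -/
def simpleSetoid : Setoid B where
  r i j := IsConj (cs.simple i) (cs.simple j)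
  iseqv := ⟨fun _ => IsConj.refl _, IsConj.symm, IsConj.trans⟩

/-- The set of `W`-conjugacy classes of simple reflections. -/
def SimpleClass : Type _ := Quotient (simpleSetoid cs)

/-- The class of a simple reflection. -/
def simpleClass (i : B) : SimpleClass cs := Quotient.mk (simpleSetoid cs) i

theorem simpleClass_eq_iff {i j : B} :
    simpleClass cs i = simpleClass cs j ↔ IsConj (cs.simple i) (cs.simple j) :=
  Quotient.eq (r := simpleSetoid cs)

theorem simpleClass_eq_of_mul_eq {i j : B} {w : W} (h : cs.simple i * w = w * cs.simple j) :
    simpleClass cs i = simpleClass cs j := by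
  rw [simpleClass_eq_iff]
  refine IsConj.symm (isConj_iff.2 ⟨w, ?_⟩)
  rw [← h]; simp

/-- A chosen reduced expression of `w`. -/
noncomputable def reducedWord (w : W) : List B := (cs.exists_isReduced w).choose

theorem isReduced_reducedWord (w : W) : cs.IsReduced (reducedWord cs w) :=
  (cs.exists_isReduced w).choose_spec.1

theorem wordProd_reducedWord (w : W) : cs.wordProd (reducedWord cs w) = w :=
  (cs.exists_isReduced w).choose_spec.2.symm

open Classical in
/-- The number of occurrences of elements of `P` in a reduced expression of `w`. -/
noncomputable def lengthIn (P : Set B) (w : W) : ℕ :=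
  (reducedWord cs w).countP (· ∈ P)

open Classical in
theorem countP_eq_of_isReduced {P : Set B}
    (hP : ∀ i j, IsConj (cs.simple i) (cs.simple j) → (i ∈ P ↔ j ∈ P)) :
    ∀ (n : ℕ) (ω ω' : List B), ω.length = n → cs.IsReduced ω → cs.IsReduced ω' →
      cs.wordProd ω = cs.wordProd ω' → ω.countP (· ∈ P) = ω'.countP (· ∈ P) := by
  intro n
  induction n with
  | zero =>
    intro ω ω' hn h h' e
    have hl : ω'.length = 0 := by rw [← h'.eq, ← e, h.eq, hn]
    rw [List.length_eq_zero_iff] at hn hl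
    rw [hn, hl]
  | succ n ih =>
    intro ω ω' hn h h' e
    obtain rfl | ⟨ν, i, rfl⟩ := List.eq_nil_or_concat ω
    · simp at hn
    have hνl : ν.length = n := by simpa using hn
    have hν : cs.IsReduced ν := by simpa [← hνl] using h.take ν.length
    have hw : cs.wordProd ω' * cs.simple i = cs.wordProd ν := by
      rw [← e, cs.wordProd_concat]; simp
    have hd : cs.length (cs.wordProd ω' * cs.simple i) < cs.length (cs.wordProd ω') := by
      rw [hw, ← e, h.eq, hν.eq]; simp
    obtain ⟨j, hj, hje, hc⟩ := exists_eraseIdx_of_rightDescent cs hd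
    have hl' : ω'.length = n + 1 := by rw [← h'.eq, ← e, h.eq, hn]
    have hr : cs.IsReduced (ω'.eraseIdx j) := by
      rw [CoxeterSystem.IsReduced, ← hje, hw, hν.eq, List.length_eraseIdx_of_lt hj]; omega
    have := ih ν (ω'.eraseIdx j) hνl hν hr (by rw [← hw, hje])
    rw [← (List.getElem_cons_eraseIdx_perm hj).countP_eq, List.concat_eq_append, List.countP_append,
      this,
      List.countP_cons, List.countP_cons, List.countP_nil, zero_add]
    simp only [decide_eq_true_eq]
    rw [if_congr (hP _ _ hc) rfl rfl]

open Classical in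
/-- If `P` is a union of conjugacy classes of simple reflections, `lengthIn cs P` can be computed
with any reduced expression. -/
theorem lengthIn_wordProd {P : Set B}
    (hP : ∀ i j, IsConj (cs.simple i) (cs.simple j) → (i ∈ P ↔ j ∈ P)) {ω : List B}
    (hω : cs.IsReduced ω) : lengthIn cs P (cs.wordProd ω) = ω.countP (· ∈ P) :=
  countP_eq_of_isReduced cs hP _ _ _ rfl (isReduced_reducedWord cs _) hω
    (wordProd_reducedWord cs _)

end Coxeter

section GroupRing

variable (Γ : Type*) [AddCommGroup Γ]

/-- The group ring `ℤ[Γ]`. -/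
abbrev GroupRing : Type _ := AddMonoidAlgebra ℤ Γ

variable {Γ}

/-- The basis element `e^γ` of `ℤ[Γ]`. -/
noncomputable def expG (γ : Γ) : GroupRing Γ := AddMonoidAlgebra.single γ 1

/-- The involution of `ℤ[Γ]` with `e^γ ↦ e^{-γ}`. -/
noncomputable def barG : GroupRing Γ →+* GroupRing Γ :=
  AddMonoidAlgebra.mapDomainRingHom ℤ (negAddMonoidHom : Γ →+ Γ)

theorem barG_expG (γ : Γ) : barG (expG γ) = expG (-γ) := by
  simp [barG, expG]

theorem expG_mul_expG_neg (γ : Γ) : expG γ * expG (-γ) = 1 := by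
  simp [expG, AddMonoidAlgebra.single_mul_single, AddMonoidAlgebra.one_def]

theorem barG_coeff (a : GroupRing Γ) (γ : Γ) : (barG a).coeff γ = a.coeff (-γ) := by
  induction a using AddMonoidAlgebra.induction_linear with
  | zero => simp
  | add x y hx hy => simp [hx, hy]
  | single g r =>
    classical
    simp [barG, Finsupp.single_apply, neg_eq_iff_eq_neg]

theorem barG_barG (a : GroupRing Γ) : barG (barG a) = a := by
  ext γ; simp [barG_coeff]

end GroupRing

section Hecke

variable {B W : Type*} [Group W] {M : CoxeterMatrix B} (cs : CoxeterSystem M W)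
variable {Γ : Type*} [AddCommGroup Γ] (φ : SimpleClass cs → Γ)

/-- The underlying module of the Hecke algebra: the free `ℤ[Γ]`-module on `W`. -/
def Hecke (_φ : SimpleClass cs → Γ) : Type _ := W →₀ GroupRing Γ

noncomputable instance : AddCommGroup (Hecke cs φ) :=
  inferInstanceAs (AddCommGroup (W →₀ GroupRing Γ))

noncomputable instance : Module (GroupRing Γ) (Hecke cs φ) :=
  inferInstanceAs (Module (GroupRing Γ) (W →₀ GroupRing Γ))

/-- The standard basis `(T_w)` of the Hecke algebra. -/
noncomputable def stdBasis : Module.Basis W (GroupRing Γ) (Hecke cs φ) :=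
  Module.Basis.ofRepr (LinearEquiv.refl (GroupRing Γ) (W →₀ GroupRing Γ))

/-- The standard basis element `T_w`. -/
noncomputable def T (w : W) : Hecke cs φ := stdBasis cs φ w

/-- `e^{φ(s)} - e^{-φ(s)}`. -/
noncomputable def xi (i : B) : GroupRing Γ :=
  expG (φ (simpleClass cs i)) - expG (-φ (simpleClass cs i))

open Classical in
/-- Left multiplication by `T_s`. -/
noncomputable def leftOp (i : B) : Module.End (GroupRing Γ) (Hecke cs φ) :=
  (stdBasis cs φ).constr (GroupRing Γ) fun w =>
    if cs.length w < cs.length (cs.simple i * w) then T cs φ (cs.simple i * w)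
    else T cs φ (cs.simple i * w) + xi cs φ i • T cs φ w

open Classical in
/-- Right multiplication by `T_s`. -/
noncomputable def rightOp (i : B) : Module.End (GroupRing Γ) (Hecke cs φ) :=
  (stdBasis cs φ).constr (GroupRing Γ) fun w =>
    if cs.length w < cs.length (w * cs.simple i) then T cs φ (w * cs.simple i)
    else T cs φ (w * cs.simple i) + xi cs φ i • T cs φ w

theorem leftOp_T_of_lt {i : B} {w : W} (h : cs.length w < cs.length (cs.simple i * w)) :
    leftOp cs φ i (T cs φ w) = T cs φ (cs.simple i * w) := by
  rw [leftOp, T, Module.Basis.constr_basis, if_pos h]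

theorem leftOp_T_of_gt {i : B} {w : W} (h : cs.length (cs.simple i * w) < cs.length w) :
    leftOp cs φ i (T cs φ w) = T cs φ (cs.simple i * w) + xi cs φ i • T cs φ w := by
  rw [leftOp, T, Module.Basis.constr_basis, if_neg h.not_gt]
  rfl

theorem rightOp_T_of_lt {i : B} {w : W} (h : cs.length w < cs.length (w * cs.simple i)) :
    rightOp cs φ i (T cs φ w) = T cs φ (w * cs.simple i) := by
  rw [rightOp, T, Module.Basis.constr_basis, if_pos h]

theorem rightOp_T_of_gt {i : B} {w : W} (h : cs.length (w * cs.simple i) < cs.length w) :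
    rightOp cs φ i (T cs φ w) = T cs φ (w * cs.simple i) + xi cs φ i • T cs φ w := by
  rw [rightOp, T, Module.Basis.constr_basis, if_neg h.not_gt]
  rfl

theorem leftOp_rightOp_T (i j : B) (w : W) :
    leftOp cs φ i (rightOp cs φ j (T cs φ w)) = rightOp cs φ j (leftOp cs φ i (T cs φ w)) := by
  have hl := cs.length_simple_mul w i
  have hr := cs.length_mul_simple w j
  have hlr := cs.length_simple_mul (w * cs.simple j) i
  have hrl := cs.length_mul_simple (cs.simple i * w) j
  have hass : cs.simple i * w * cs.simple j = cs.simple i * (w * cs.simple j) := mul_assoc _ _ _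
  have key : cs.simple i * w = w * cs.simple j → xi cs φ i = xi cs φ j := by
    intro h; rw [xi, xi, simpleClass_eq_of_mul_eq cs h]
  rw [hass] at hrl
  rcases hl with hl | hl <;> rcases hr with hr | hr
  · rw [leftOp_T_of_lt cs φ (w := w) (by omega), rightOp_T_of_lt cs φ (w := w) (by omega)]
    rcases hlr with hlr | hlr
    · rw [leftOp_T_of_lt cs φ (by omega), rightOp_T_of_lt cs φ (by rw [hass]; omega), hass]
    · have e := simple_mul_eq_mul_simple cs (w := w) (i := i) (j := j) (by omega)
        (by rw [hass]; omega) (by omega)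
      rw [leftOp_T_of_gt cs φ (by omega), rightOp_T_of_gt cs φ (by rw [hass]; omega), hass, key e,
        e]
  · rw [leftOp_T_of_lt cs φ (w := w) (by omega), rightOp_T_of_gt cs φ (w := w) (by omega),
      map_add, map_smul, leftOp_T_of_lt cs φ (w := w) (by omega),
      leftOp_T_of_lt cs φ (by omega), rightOp_T_of_gt cs φ (by rw [hass]; omega), hass]
  · rw [leftOp_T_of_gt cs φ (w := w) (by omega), rightOp_T_of_lt cs φ (w := w) (by omega),
      map_add, map_smul, rightOp_T_of_lt cs φ (w := w) (by omega),
      leftOp_T_of_gt cs φ (by omega), rightOp_T_of_lt cs φ (by rw [hass]; omega), hass]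
  · rw [leftOp_T_of_gt cs φ (w := w) (by omega), rightOp_T_of_gt cs φ (w := w) (by omega),
      map_add, map_smul, map_add, map_smul, rightOp_T_of_gt cs φ (w := w) (by omega),
      leftOp_T_of_gt cs φ (w := w) (by omega)]
    rcases hlr with hlr | hlr
    · have e := simple_mul_eq_mul_simple cs (w := cs.simple i * w) (i := i) (j := j)
        (by simp; omega) (by simp; omega) (by rw [hass]; omega)
      have e' : cs.simple i * w = w * cs.simple j := by
        rw [cs.simple_mul_simple_cancel_left] at e
        nth_rw 2 [e]
        simp
      rw [leftOp_T_of_lt cs φ (by omega), rightOp_T_of_lt cs φ (by rw [hass]; omega), hass,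
        key e', e']
    · rw [leftOp_T_of_gt cs φ (by omega), rightOp_T_of_gt cs φ (by rw [hass]; omega), hass]
      simp only [smul_add, smul_smul, mul_comm (xi cs φ j)]
      abel

theorem leftOp_rightOp (i j : B) :
    leftOp cs φ i * rightOp cs φ j = rightOp cs φ j * leftOp cs φ i :=
  (stdBasis cs φ).ext fun w => leftOp_rightOp_T cs φ i j w

/-- Left multiplication by `T_w`: the product of the operators attached to the letters of a reduced
expression of `w`. -/
noncomputable def leftOpW (w : W) : Module.End (GroupRing Γ) (Hecke cs φ) :=
  ((reducedWord cs w).map (leftOp cs φ)).prod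

/-- Left multiplication by an arbitrary element. -/
noncomputable def mulLeftOp : Hecke cs φ →ₗ[GroupRing Γ] Module.End (GroupRing Γ) (Hecke cs φ) :=
  (stdBasis cs φ).constr (GroupRing Γ) (leftOpW cs φ)

theorem prod_leftOp_T_one {ω : List B} (h : cs.IsReduced ω) :
    (ω.map (leftOp cs φ)).prod (T cs φ 1) = T cs φ (cs.wordProd ω) := by
  induction ω with
  | nil => simp
  | cons i ω ih =>
    have hω : cs.IsReduced ω := by simpa using h.drop 1
    rw [List.map_cons, List.prod_cons, Module.End.mul_apply, ih hω, leftOp_T_of_lt, cs.wordProd_cons]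
    rw [← cs.wordProd_cons, h.eq, hω.eq]; simp

theorem mulLeftOp_T_one (h : Hecke cs φ) : mulLeftOp cs φ h (T cs φ 1) = h := by
  have : (mulLeftOp cs φ).flip (T cs φ 1) = LinearMap.id := by
    refine (stdBasis cs φ).ext fun w => ?_
    rw [LinearMap.flip_apply, mulLeftOp, Module.Basis.constr_basis, leftOpW,
      prod_leftOp_T_one cs φ (isReduced_reducedWord cs w), wordProd_reducedWord]
    rfl
  exact LinearMap.congr_fun this h

/-- An operator commuting with all right multiplications is determined by its value at `T_1`. -/
theorem op_ext {f g : Module.End (GroupRing Γ) (Hecke cs φ)}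
    (hf : ∀ i, Commute f (rightOp cs φ i)) (hg : ∀ i, Commute g (rightOp cs φ i))
    (h : f (T cs φ 1) = g (T cs φ 1)) : f = g := by
  have key : ∀ (n : ℕ) (w : W), cs.length w = n → f (T cs φ w) = g (T cs φ w) := by
    intro n
    induction n with
    | zero =>
      intro w hw
      rw [cs.length_eq_zero_iff] at hw
      rw [hw, h]
    | succ n ih =>
      intro w hw
      obtain ⟨i, hi⟩ := cs.exists_rightDescent_of_ne_one (w := w) (by
        rintro rfl; simp at hw)
      have hi' : cs.length (w * cs.simple i) < cs.length w := hi
      have hn : cs.length (w * cs.simple i) = n := by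
        have := cs.length_mul_simple w i
        omega
      have e : T cs φ w = rightOp cs φ i (T cs φ (w * cs.simple i)) := by
        rw [rightOp_T_of_lt cs φ (by simpa using hi')]; simp
      have h1 := LinearMap.congr_fun (hf i) (T cs φ (w * cs.simple i))
      have h2 := LinearMap.congr_fun (hg i) (T cs φ (w * cs.simple i))
      rw [Module.End.mul_apply, Module.End.mul_apply] at h1 h2
      rw [e, h1, h2, ih _ hn]
  exact (stdBasis cs φ).ext fun w => key _ w rfl

theorem commute_mulLeftOp (h : Hecke cs φ) (j : B) :
    Commute (mulLeftOp cs φ h) (rightOp cs φ j) := by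
  rw [mulLeftOp, Module.Basis.constr_apply, Finsupp.sum]
  refine Commute.sum_left _ _ _ fun w _ => Commute.smul_left ?_ _
  refine Commute.list_prod_left _ _ fun f hf => ?_
  obtain ⟨i, -, rfl⟩ := List.mem_map.1 hf
  exact leftOp_rightOp cs φ i j

noncomputable instance : Mul (Hecke cs φ) := ⟨fun h h' => mulLeftOp cs φ h h'⟩

noncomputable instance : One (Hecke cs φ) := ⟨T cs φ 1⟩

theorem mul_def (h h' : Hecke cs φ) : h * h' = mulLeftOp cs φ h h' := rfl

theorem one_def : (1 : Hecke cs φ) = T cs φ 1 := rfl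

theorem mulLeftOp_mul (h h' : Hecke cs φ) :
    mulLeftOp cs φ (h * h') = mulLeftOp cs φ h * mulLeftOp cs φ h' := by
  refine op_ext cs φ (commute_mulLeftOp cs φ _)
    (fun i => (commute_mulLeftOp cs φ h i).mul_left (commute_mulLeftOp cs φ h' i)) ?_
  rw [mulLeftOp_T_one, Module.End.mul_apply, mulLeftOp_T_one, mul_def]

theorem mulLeftOp_one : mulLeftOp cs φ 1 = 1 := by
  refine op_ext cs φ (commute_mulLeftOp cs φ _) (fun i => Commute.one_left _) ?_
  rw [mulLeftOp_T_one, one_def, Module.End.one_apply]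

/-- The Hecke algebra is a ring. -/
noncomputable instance : Ring (Hecke cs φ) :=
  { (inferInstance : AddCommGroup (Hecke cs φ)), (inferInstance : Mul (Hecke cs φ)),
    (inferInstance : One (Hecke cs φ)) with
    left_distrib := fun a b c => by simp only [mul_def, map_add]
    right_distrib := fun a b c => by simp only [mul_def, map_add, LinearMap.add_apply]
    zero_mul := fun a => by simp only [mul_def, map_zero, LinearMap.zero_apply]
    mul_zero := fun a => by simp only [mul_def, map_zero]
    mul_assoc := fun a b c => by
      rw [mul_def cs φ (a * b) c, mulLeftOp_mul, Module.End.mul_apply, ← mul_def, ← mul_def]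
    one_mul := fun a => by rw [mul_def, mulLeftOp_one, Module.End.one_apply]
    mul_one := fun a => by rw [mul_def, one_def, mulLeftOp_T_one] }

/-- The Hecke algebra is an algebra over `ℤ[Γ]`. -/
noncomputable instance : Algebra (GroupRing Γ) (Hecke cs φ) :=
  Algebra.ofModule (fun r x y => by simp only [mul_def, map_smul, LinearMap.smul_apply])
    (fun r x y => by simp only [mul_def, map_smul])

/-! ### The defining relations -/

theorem T_one : T cs φ 1 = 1 := rfl

theorem mulLeftOp_T_simple (i : B) : mulLeftOp cs φ (T cs φ (cs.simple i)) = leftOp cs φ i := by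
  refine op_ext cs φ (commute_mulLeftOp cs φ _) (fun j => leftOp_rightOp cs φ i j) ?_
  rw [mulLeftOp_T_one, leftOp_T_of_lt cs φ (by simp)]; simp

theorem T_simple_mul_of_lt {i : B} {w : W} (h : cs.length w < cs.length (cs.simple i * w)) :
    T cs φ (cs.simple i) * T cs φ w = T cs φ (cs.simple i * w) := by
  rw [mul_def, mulLeftOp_T_simple, leftOp_T_of_lt cs φ h]

theorem T_simple_mul_of_gt {i : B} {w : W} (h : cs.length (cs.simple i * w) < cs.length w) :
    T cs φ (cs.simple i) * T cs φ w = T cs φ (cs.simple i * w) + xi cs φ i • T cs φ w := by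
  rw [mul_def, mulLeftOp_T_simple, leftOp_T_of_gt cs φ h]

theorem T_mul_T {w w' : W} (h : cs.length (w * w') = cs.length w + cs.length w') :
    T cs φ w * T cs φ w' = T cs φ (w * w') := by
  induction hn : cs.length w generalizing w with
  | zero =>
    rw [cs.length_eq_zero_iff] at hn
    rw [hn, T_one, one_mul, one_mul]
  | succ n ih =>
    obtain ⟨i, hi⟩ := cs.exists_leftDescent_of_ne_one (w := w) (by rintro rfl; simp at hn)
    have hi' : cs.length (cs.simple i * w) < cs.length w := hi
    obtain ⟨v, rfl⟩ : ∃ v, w = cs.simple i * v := ⟨cs.simple i * w, by simp⟩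
    rw [cs.simple_mul_simple_cancel_left] at hi'
    have h1 := cs.length_simple_mul v i
    have h2 := cs.length_simple_mul (v * w') i
    have h3 := cs.length_mul_le v w'
    rw [← mul_assoc] at h2
    rw [← T_simple_mul_of_lt cs φ hi', mul_assoc, ih (by omega) (by omega),
      T_simple_mul_of_lt cs φ (by rw [← mul_assoc]; omega), mul_assoc]

theorem T_simple_sq (i : B) :
    T cs φ (cs.simple i) * T cs φ (cs.simple i) = 1 + xi cs φ i • T cs φ (cs.simple i) := by
  rw [T_simple_mul_of_gt cs φ (by simp)]; simp [T_one]

theorem T_simple_quadratic (i : B) :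
    (T cs φ (cs.simple i) - algebraMap _ _ (expG (φ (simpleClass cs i)))) *
      (T cs φ (cs.simple i) + algebraMap _ _ (expG (-φ (simpleClass cs i)))) = 0 := by
  rw [sub_mul, mul_add, mul_add, T_simple_sq, ← map_mul, expG_mul_expG_neg, map_one,
    ← Algebra.commutes, xi, sub_smul, Algebra.smul_def, Algebra.smul_def]
  abel

end Hecke

section Bar

variable {B W : Type*} [Group W] {M : CoxeterMatrix B} (cs : CoxeterSystem M W)
variable {Γ : Type*} [AddCommGroup Γ] (φ : SimpleClass cs → Γ)

/-- `T_s - (e^{φ(s)} - e^{-φ(s)})`, the inverse of `T_s`. -/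
noncomputable def TsInv (i : B) : Hecke cs φ :=
  T cs φ (cs.simple i) - xi cs φ i • 1

theorem T_simple_mul_TsInv (i : B) : T cs φ (cs.simple i) * TsInv cs φ i = 1 := by
  rw [TsInv, mul_sub, T_simple_sq, mul_smul_comm, mul_one, add_sub_cancel_right]

theorem TsInv_mul_T_simple (i : B) : TsInv cs φ i * T cs φ (cs.simple i) = 1 := by
  rw [TsInv, sub_mul, T_simple_sq, smul_mul_assoc, one_mul, add_sub_cancel_right]

theorem isUnit_T (w : W) : IsUnit (T cs φ w) := by
  induction hn : cs.length w generalizing w with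
  | zero =>
    rw [cs.length_eq_zero_iff] at hn
    rw [hn, T_one]; exact isUnit_one
  | succ n ih =>
    obtain ⟨i, hi⟩ := cs.exists_leftDescent_of_ne_one (w := w) (by rintro rfl; simp at hn)
    have hi' : cs.length (cs.simple i * w) < cs.length w := hi
    have h1 := cs.length_simple_mul w i
    have h2 := T_simple_mul_of_lt cs φ (i := i) (w := cs.simple i * w) (by simpa using hi')
    rw [cs.simple_mul_simple_cancel_left] at h2
    rw [← h2]
    exact IsUnit.mul ⟨⟨_, _, T_simple_mul_TsInv cs φ i, TsInv_mul_T_simple cs φ i⟩, rfl⟩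
      (ih _ (by omega))

/-- `\overline{T_w} = T_{w⁻¹}⁻¹`. -/
noncomputable def barT (w : W) : Hecke cs φ := ((isUnit_T cs φ w⁻¹).unit⁻¹ : (Hecke cs φ)ˣ)

/-- The bar involution `∑ a_w T_w ↦ ∑ \overline{a_w} T_{w⁻¹}⁻¹`. -/
noncomputable def bar (h : Hecke cs φ) : Hecke cs φ :=
  ((stdBasis cs φ).repr h).sum fun w a => barG a • barT cs φ w

theorem barT_eq_of_mul {w : W} {x : Hecke cs φ} (h : x * T cs φ w⁻¹ = 1) :
    barT cs φ w = x := by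
  exact Units.inv_eq_of_mul_eq_one_left h

theorem barT_mul (w : W) : barT cs φ w * T cs φ w⁻¹ = 1 := by
  rw [barT]; exact (isUnit_T cs φ w⁻¹).val_inv_mul

theorem barT_one : barT cs φ 1 = 1 := barT_eq_of_mul cs φ (by rw [inv_one, T_one, mul_one])

theorem barT_simple_mul {i : B} {w : W} (h : cs.length w < cs.length (cs.simple i * w)) :
    barT cs φ (cs.simple i * w) = TsInv cs φ i * barT cs φ w := by
  apply barT_eq_of_mul
  have h1 := cs.length_simple_mul w i
  have : T cs φ (cs.simple i * w)⁻¹ = T cs φ w⁻¹ * T cs φ (cs.simple i) := by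
    rw [T_mul_T]
    · simp
    · rw [← cs.inv_simple i, ← mul_inv_rev, cs.length_inv, cs.length_inv, cs.length_inv,
        cs.length_simple]
      omega
  rw [this, mul_assoc, ← mul_assoc _ (T cs φ w⁻¹), barT_mul, one_mul, TsInv_mul_T_simple]

theorem bar_add (x y : Hecke cs φ) : bar cs φ (x + y) = bar cs φ x + bar cs φ y := by
  rw [bar, map_add, Finsupp.sum_add_index'] <;> simp [bar, add_smul]

theorem bar_zero : bar cs φ 0 = 0 := by simp [bar]

theorem bar_smul (a : GroupRing Γ) (x : Hecke cs φ) :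
    bar cs φ (a • x) = barG a • bar cs φ x := by
  rw [bar, map_smul, Finsupp.sum_smul_index' (by simp), bar, Finsupp.smul_sum]
  simp [mul_smul]

theorem bar_neg (x : Hecke cs φ) : bar cs φ (-x) = -bar cs φ x := by
  rw [← neg_one_smul (GroupRing Γ), bar_smul]; simp

theorem bar_sub (x y : Hecke cs φ) : bar cs φ (x - y) = bar cs φ x - bar cs φ y := by
  rw [sub_eq_add_neg, bar_add, bar_neg, sub_eq_add_neg]

theorem bar_T (w : W) : bar cs φ (T cs φ w) = barT cs φ w := by
  rw [bar, T, Module.Basis.repr_self, Finsupp.sum_single_index] <;> simp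

theorem hecke_induction {p : Hecke cs φ → Prop} (zero : p 0) (add : ∀ x y, p x → p y → p (x + y))
    (smul : ∀ (a : GroupRing Γ) w, p (a • T cs φ w)) (h : Hecke cs φ) : p h := by
  rw [← (stdBasis cs φ).linearCombination_repr h, Finsupp.linearCombination_apply]
  exact Finset.sum_induction _ p add zero fun w _ => smul _ w

theorem barG_xi (i : B) : barG (xi cs φ i) = -xi cs φ i := by
  rw [xi, map_sub, barG_expG, barG_expG]; simp

theorem bar_T_simple_mul (i : B) (h : Hecke cs φ) :
    bar cs φ (T cs φ (cs.simple i) * h) = TsInv cs φ i * bar cs φ h := by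
  induction h using hecke_induction with
  | zero => simp [bar_zero]
  | add x y hx hy => rw [mul_add, bar_add, bar_add, mul_add, hx, hy]
  | smul a w =>
    rw [mul_smul_comm, bar_smul, bar_smul, mul_smul_comm]
    congr 1
    rcases cs.length_simple_mul w i with hl | hl
    · rw [T_simple_mul_of_lt cs φ (by omega), bar_T, bar_T, barT_simple_mul cs φ (by omega)]
    · rw [T_simple_mul_of_gt cs φ (by omega), bar_add, bar_smul, bar_T, bar_T]
      have e := barT_simple_mul cs φ (i := i) (w := cs.simple i * w) (by simp; omega)
      rw [cs.simple_mul_simple_cancel_left] at e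
      have e' : TsInv cs φ i * TsInv cs φ i = 1 - xi cs φ i • TsInv cs φ i := by
        nth_rw 1 [TsInv]
        rw [sub_mul, T_simple_mul_TsInv, smul_mul_assoc, one_mul]
      rw [e, ← mul_assoc, e', barG_xi, sub_mul, one_mul, neg_smul, smul_mul_assoc, sub_eq_add_neg]

theorem bar_bar (h : Hecke cs φ) : bar cs φ (bar cs φ h) = h := by
  induction h using hecke_induction with
  | zero => simp [bar_zero]
  | add x y hx hy => rw [bar_add, bar_add, hx, hy]
  | smul a w =>
    rw [bar_smul, bar_smul, barG_barG]
    congr 1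
    induction hn : cs.length w generalizing w with
    | zero =>
      rw [cs.length_eq_zero_iff] at hn
      rw [hn, bar_T, barT_one, ← T_one, bar_T, barT_one, T_one]
    | succ n ih =>
      obtain ⟨i, hi⟩ := cs.exists_leftDescent_of_ne_one (w := w) (by rintro rfl; simp at hn)
      have hi' : cs.length (cs.simple i * w) < cs.length w := hi
      have h1 := cs.length_simple_mul w i
      have h2 := T_simple_mul_of_lt cs φ (i := i) (w := cs.simple i * w) (by simpa using hi')
      rw [cs.simple_mul_simple_cancel_left] at h2
      have h3 := ih (cs.simple i * w) (by omega)
      rw [← h2, bar_T_simple_mul]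
      nth_rw 1 [TsInv]
      rw [sub_mul, bar_sub, bar_T_simple_mul, smul_mul_assoc, one_mul, bar_smul, h3, barG_xi, TsInv,
        sub_mul, smul_mul_assoc, one_mul, neg_smul]
      abel

/-! ### Triangularity of the bar involution -/

/-- The span of the `T_y` with `ℓ(y) < n`. -/
noncomputable def shorter (n : ℕ) : Submodule (GroupRing Γ) (Hecke cs φ) :=
  Submodule.span (GroupRing Γ) (T cs φ '' {y | cs.length y < n})

theorem T_mem_shorter {n : ℕ} {y : W} (h : cs.length y < n) : T cs φ y ∈ shorter cs φ n :=
  Submodule.subset_span ⟨y, h, rfl⟩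

theorem shorter_mono {m n : ℕ} (h : m ≤ n) : shorter cs φ m ≤ shorter cs φ n :=
  Submodule.span_mono (Set.image_mono fun _ hy => lt_of_lt_of_le hy h)

theorem mem_shorter_iff {n : ℕ} {h : Hecke cs φ} :
    h ∈ shorter cs φ n ↔ ∀ y, n ≤ cs.length y → (stdBasis cs φ).repr h y = 0 := by
  have : shorter cs φ n =
      Submodule.span (GroupRing Γ) (stdBasis cs φ '' {y | cs.length y < n}) := rfl
  rw [this, Module.Basis.mem_span_image]
  constructor
  · intro hs y hy
    by_contra hne
    have := hs (Finsupp.mem_support_iff.2 hne)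
    simp only [Set.mem_ofPred_eq] at this
    omega
  · intro hs y hy
    by_contra hne
    exact Finsupp.mem_support_iff.1 hy (hs y (by simpa using hne))

theorem T_simple_mul_mem_shorter (i : B) {n : ℕ} {h : Hecke cs φ} (hh : h ∈ shorter cs φ n) :
    T cs φ (cs.simple i) * h ∈ shorter cs φ (n + 1) := by
  induction hh using Submodule.span_induction with
  | zero => simp
  | add x y _ _ hx hy => rw [mul_add]; exact add_mem hx hy
  | smul a x _ hx => rw [mul_smul_comm]; exact Submodule.smul_mem _ _ hx
  | mem x hx =>
    obtain ⟨y, hy, rfl⟩ := hx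
    simp only [Set.mem_ofPred_eq] at hy
    rcases cs.length_simple_mul y i with hl | hl
    · rw [T_simple_mul_of_lt cs φ (by omega)]
      exact T_mem_shorter cs φ (by omega)
    · rw [T_simple_mul_of_gt cs φ (by omega)]
      exact add_mem (T_mem_shorter cs φ (by omega))
        (Submodule.smul_mem _ _ (T_mem_shorter cs φ (by omega)))

theorem bar_T_sub_mem (w : W) : bar cs φ (T cs φ w) - T cs φ w ∈ shorter cs φ (cs.length w) := by
  induction hn : cs.length w generalizing w with
  | zero =>
    rw [cs.length_eq_zero_iff] at hn
    rw [hn, bar_T, barT_one, T_one, sub_self]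
    exact zero_mem _
  | succ n ih =>
    obtain ⟨i, hi⟩ := cs.exists_leftDescent_of_ne_one (w := w) (by rintro rfl; simp at hn)
    have hi' : cs.length (cs.simple i * w) < cs.length w := hi
    have h1 := cs.length_simple_mul w i
    have h2 := T_simple_mul_of_lt cs φ (i := i) (w := cs.simple i * w) (by simpa using hi')
    rw [cs.simple_mul_simple_cancel_left] at h2
    have h3 := ih (cs.simple i * w) (by omega)
    have h4 := T_simple_mul_mem_shorter cs φ i h3
    have h5 : bar cs φ (T cs φ (cs.simple i * w)) ∈ shorter cs φ (n + 1) := by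
      rw [← sub_add_cancel (bar cs φ (T cs φ (cs.simple i * w))) (T cs φ (cs.simple i * w))]
      exact add_mem (shorter_mono cs φ (by omega) h3) (T_mem_shorter cs φ (by omega))
    rw [← h2, bar_T_simple_mul, TsInv, sub_mul, smul_mul_assoc, one_mul]
    have : T cs φ (cs.simple i) * bar cs φ (T cs φ (cs.simple i * w)) -
        xi cs φ i • bar cs φ (T cs φ (cs.simple i * w)) -
        T cs φ (cs.simple i) * T cs φ (cs.simple i * w) =
        T cs φ (cs.simple i) * (bar cs φ (T cs φ (cs.simple i * w)) - T cs φ (cs.simple i * w)) -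
        xi cs φ i • bar cs φ (T cs φ (cs.simple i * w)) := by
      rw [mul_sub]; abel
    rw [this]
    exact sub_mem h4 (Submodule.smul_mem _ _ h5)

theorem bar_mem_shorter {n : ℕ} {h : Hecke cs φ} (hh : h ∈ shorter cs φ n) :
    bar cs φ h ∈ shorter cs φ n := by
  induction hh using Submodule.span_induction with
  | zero => simp [bar_zero]
  | add x y _ _ hx hy => rw [bar_add]; exact add_mem hx hy
  | smul a x _ hx => rw [bar_smul]; exact Submodule.smul_mem _ _ hx
  | mem x hx =>
    obtain ⟨y, hy, rfl⟩ := hx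
    simp only [Set.mem_ofPred_eq] at hy
    rw [← sub_add_cancel (bar cs φ (T cs φ y)) (T cs φ y)]
    exact add_mem (shorter_mono cs φ (by omega) (bar_T_sub_mem cs φ y)) (T_mem_shorter cs φ hy)

/-- The coefficient of a longest term is conjugated by the bar involution. -/
theorem repr_bar_of_mem_shorter {n : ℕ} {h : Hecke cs φ} (hh : h ∈ shorter cs φ (n + 1)) {y : W}
    (hy : cs.length y = n) :
    (stdBasis cs φ).repr (bar cs φ h) y = barG ((stdBasis cs φ).repr h y) := by
  induction hh using Submodule.span_induction with
  | zero => simp [bar_zero]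
  | add x z _ _ hx hz => simp [bar_add, hx, hz]
  | smul a x _ hx => simp [bar_smul, hx]
  | mem x hx =>
    obtain ⟨z, hz, rfl⟩ := hx
    simp only [Set.mem_ofPred_eq] at hz
    have h1 := (mem_shorter_iff cs φ).1 (bar_T_sub_mem cs φ z) y (by omega)
    rw [map_sub, Finsupp.sub_apply, sub_eq_zero] at h1
    classical
    rw [h1, T, Module.Basis.repr_self, Finsupp.single_apply]
    split_ifs <;> simp

theorem exists_mem_shorter (h : Hecke cs φ) : ∃ n, h ∈ shorter cs φ n := by
  refine ⟨((stdBasis cs φ).repr h).support.sup cs.length + 1, ?_⟩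
  rw [mem_shorter_iff]
  intro y hy
  by_contra hne
  have := Finset.le_sup (f := cs.length) (Finsupp.mem_support_iff.2 hne)
  omega

theorem eq_zero_of_mem_shorter_zero {h : Hecke cs φ} (hh : h ∈ shorter cs φ 0) : h = 0 := by
  rw [mem_shorter_iff] at hh
  apply (stdBasis cs φ).repr.injective
  ext1 y
  rw [hh y (Nat.zero_le _)]; simp

end Bar

section KL

variable {Γ : Type*} [AddCommGroup Γ] [LinearOrder Γ]

variable (Γ) in
/-- `ℤ[Γ_{<0}]`. -/
def negG : AddSubgroup (GroupRing Γ) where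
  carrier := {a | ∀ γ, a.coeff γ ≠ 0 → γ < 0}
  zero_mem' := fun γ h => absurd rfl h
  add_mem' := by
    intro a b ha hb γ h
    by_cases h1 : a.coeff γ = 0
    · exact hb γ fun h2 => h (by simp [h1, h2])
    · exact ha γ h1
  neg_mem' := by
    intro a ha γ h
    exact ha γ fun h1 => h (by simp [h1])

theorem mem_negG {a : GroupRing Γ} : a ∈ negG Γ ↔ ∀ γ, a.coeff γ ≠ 0 → γ < 0 := Iff.rfl

/-- The part of an element of `ℤ[Γ]` supported on negative exponents. -/
noncomputable def negPartG (a : GroupRing Γ) : GroupRing Γ :=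
  AddMonoidAlgebra.ofCoeff (a.coeff.filter (· < 0))

theorem negPartG_coeff (a : GroupRing Γ) (γ : Γ) :
    (negPartG a).coeff γ = if γ < 0 then a.coeff γ else 0 := by
  rw [negPartG, AddMonoidAlgebra.coeff_ofCoeff, Finsupp.filter_apply]

theorem negPartG_zero : negPartG (0 : GroupRing Γ) = 0 := by
  ext γ; simp [negPartG_coeff]

theorem negPartG_mem (a : GroupRing Γ) : negPartG a ∈ negG Γ := by
  intro γ h
  rw [negPartG_coeff] at h
  by_contra hc
  exact h (if_neg hc)

variable [IsOrderedAddMonoid Γ]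

theorem negPartG_sub_bar {a : GroupRing Γ} (h : barG a = -a) :
    negPartG a - barG (negPartG a) = a := by
  ext γ
  have h1 : a.coeff (-γ) = -a.coeff γ := by rw [← barG_coeff, h]; simp
  rw [AddMonoidAlgebra.coeff_sub, Finsupp.sub_apply, barG_coeff, negPartG_coeff, negPartG_coeff, h1]
  rcases lt_trichotomy γ 0 with hγ | hγ | hγ
  · rw [if_pos hγ, if_neg (by simpa using hγ.le)]; simp
  · subst hγ
    rw [neg_zero] at h1 ⊢
    simp only [lt_irrefl, if_false]
    omega
  · rw [if_neg hγ.not_gt, if_pos (by simpa using hγ)]; simp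

theorem eq_zero_of_mem_negG {a : GroupRing Γ} (ha : a ∈ negG Γ) (h : barG a = a) : a = 0 := by
  ext γ
  by_contra hne
  have hne' : a.coeff γ ≠ 0 := hne
  have h1 := ha γ hne'
  have h2 := ha (-γ) (by rwa [← barG_coeff, h])
  rw [neg_lt_zero] at h2
  exact lt_asymm h1 h2

variable {B W : Type*} [Group W] {M : CoxeterMatrix B} (cs : CoxeterSystem M W)
variable (φ : SimpleClass cs → Γ)

/-- `H_{<0}`: the elements all of whose coordinates on the standard basis lie in `ℤ[Γ_{<0}]`. -/
def heckeNeg : AddSubgroup (Hecke cs φ) where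
  carrier := {h | ∀ w, (stdBasis cs φ).repr h w ∈ negG Γ}
  zero_mem' := fun w => by simp [zero_mem]
  add_mem' := fun ha hb w => by
    rw [map_add, Finsupp.add_apply]; exact add_mem (ha w) (hb w)
  neg_mem' := fun ha w => by
    rw [map_neg, Finsupp.neg_apply]; exact neg_mem (ha w)

theorem eq_zero_of_mem_heckeNeg {p : Hecke cs φ} (hp : p ∈ heckeNeg cs φ)
    (h : bar cs φ p = p) : p = 0 := by
  obtain ⟨n, hn⟩ := exists_mem_shorter cs φ p
  induction n with
  | zero => exact eq_zero_of_mem_shorter_zero cs φ hn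
  | succ n ih =>
    apply ih
    rw [mem_shorter_iff]
    intro y hy
    rcases hy.eq_or_lt with hy | hy
    · have h1 := repr_bar_of_mem_shorter cs φ hn hy.symm
      rw [h] at h1
      exact eq_zero_of_mem_negG (hp y) h1.symm
    · exact (mem_shorter_iff cs φ).1 hn y hy

theorem exists_sub_bar (n : ℕ) : ∀ d ∈ shorter cs φ n, bar cs φ d = -d →
    ∃ p ∈ shorter cs φ n, p ∈ heckeNeg cs φ ∧ p - bar cs φ p = d := by
  induction n with
  | zero =>
    intro d hd _
    exact ⟨0, zero_mem _, zero_mem _, by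
      rw [eq_zero_of_mem_shorter_zero cs φ hd, bar_zero, sub_zero]⟩
  | succ n ih =>
    intro d hd hbar
    obtain ⟨q, hq⟩ : ∃ q : Hecke cs φ, ∀ y, (stdBasis cs φ).repr q y =
        negPartG ((stdBasis cs φ).repr d y) :=
      ⟨(stdBasis cs φ).repr.symm
        (((stdBasis cs φ).repr d).mapRange negPartG negPartG_zero), fun y => by simp⟩
    have hqs : q ∈ shorter cs φ (n + 1) := by
      rw [mem_shorter_iff]
      intro y hy
      rw [hq, (mem_shorter_iff cs φ).1 hd y hy, negPartG_zero]
    have hqn : q ∈ heckeNeg cs φ := fun y => by rw [hq]; exact negPartG_mem _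
    obtain ⟨p, hps, hpn, hpd⟩ := ih (d - (q - bar cs φ q)) (by
      rw [mem_shorter_iff]
      intro y hy
      rcases hy.eq_or_lt with hy | hy
      · have h1 := repr_bar_of_mem_shorter cs φ hd hy.symm
        rw [hbar, map_neg, Finsupp.neg_apply] at h1
        rw [map_sub, map_sub, Finsupp.sub_apply, Finsupp.sub_apply,
          repr_bar_of_mem_shorter cs φ hqs hy.symm, hq, negPartG_sub_bar h1.symm, sub_self]
      · exact (mem_shorter_iff cs φ).1
          (sub_mem hd (sub_mem hqs (bar_mem_shorter cs φ hqs))) y hy) (by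
      rw [bar_sub, bar_sub, bar_bar, hbar]; abel)
    refine ⟨p + q, add_mem (shorter_mono cs φ (Nat.le_succ n) hps) hqs, add_mem hpn hqn, ?_⟩
    rw [bar_add, add_sub_add_comm, hpd]; abel

/-- `c` is bar-invariant and congruent to `T_w` modulo `H_{<0}`. -/
def IsKLElement (w : W) (c : Hecke cs φ) : Prop :=
  bar cs φ c = c ∧ c - T cs φ w ∈ heckeNeg cs φ

theorem exists_isKLElement (w : W) :
    ∃ c, IsKLElement cs φ w c ∧ c - T cs φ w ∈ shorter cs φ (cs.length w) := by
  obtain ⟨p, hps, hpn, hpd⟩ := exists_sub_bar cs φ (cs.length w)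
    (bar cs φ (T cs φ w) - T cs φ w) (bar_T_sub_mem cs φ w) (by
      rw [bar_sub, bar_bar]; abel)
  refine ⟨T cs φ w + p, ⟨?_, by simpa using hpn⟩, by simpa using hps⟩
  rw [sub_eq_sub_iff_add_eq_add] at hpd
  rw [bar_add, ← hpd, add_comm]

theorem isKLElement_unique {w : W} {c c' : Hecke cs φ} (h : IsKLElement cs φ w c)
    (h' : IsKLElement cs φ w c') : c = c' := by
  rw [← sub_eq_zero]
  apply eq_zero_of_mem_heckeNeg cs φ
  · have := sub_mem h.2 h'.2
    rwa [sub_sub_sub_cancel_right] at this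
  · rw [bar_sub, h.1, h'.1]

theorem existsUnique_isKLElement (w : W) : ∃! c, IsKLElement cs φ w c := by
  obtain ⟨c, hc, -⟩ := exists_isKLElement cs φ w
  exact ⟨c, hc, fun c' hc' => isKLElement_unique cs φ hc' hc⟩

/-- The Kazhdan–Lusztig element `C_w`. -/
noncomputable def C (w : W) : Hecke cs φ := (existsUnique_isKLElement cs φ w).choose

theorem isKLElement_C (w : W) : IsKLElement cs φ w (C cs φ w) :=
  (existsUnique_isKLElement cs φ w).choose_spec.1

theorem C_sub_T_mem (w : W) : C cs φ w - T cs φ w ∈ shorter cs φ (cs.length w) := by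
  obtain ⟨c, hc, hcs⟩ := exists_isKLElement cs φ w
  rwa [isKLElement_unique cs φ (isKLElement_C cs φ w) hc]

/-- The linear map `T_w ↦ C_w`. -/
noncomputable def klMap : Hecke cs φ →ₗ[GroupRing Γ] Hecke cs φ :=
  (stdBasis cs φ).constr (GroupRing Γ) (C cs φ)

theorem klMap_T (w : W) : klMap cs φ (T cs φ w) = C cs φ w :=
  Module.Basis.constr_basis _ _ _ _

theorem klMap_sub_mem {n : ℕ} {h : Hecke cs φ} (hh : h ∈ shorter cs φ (n + 1)) :
    klMap cs φ h - h ∈ shorter cs φ n := by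
  induction hh using Submodule.span_induction with
  | zero => simp
  | add x y _ _ hx hy => rw [map_add, add_sub_add_comm]; exact add_mem hx hy
  | smul a x _ hx => rw [map_smul, ← smul_sub]; exact Submodule.smul_mem _ _ hx
  | mem x hx =>
    obtain ⟨y, hy, rfl⟩ := hx
    simp only [Set.mem_ofPred_eq] at hy
    rw [klMap_T]
    exact shorter_mono cs φ (by omega) (C_sub_T_mem cs φ y)

theorem klMap_bijective : Function.Bijective (klMap cs φ) := by
  constructor
  · rw [injective_iff_map_eq_zero]
    intro h hh
    obtain ⟨n, hn⟩ := exists_mem_shorter cs φ h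
    induction n with
    | zero => exact eq_zero_of_mem_shorter_zero cs φ hn
    | succ n ih =>
      apply ih
      have := klMap_sub_mem cs φ hn
      rw [hh, zero_sub] at this
      simpa using this
  · intro h
    obtain ⟨n, hn⟩ := exists_mem_shorter cs φ h
    induction n generalizing h with
    | zero => exact ⟨0, by rw [eq_zero_of_mem_shorter_zero cs φ hn, map_zero]⟩
    | succ n ih =>
      obtain ⟨g, hg⟩ := ih _ (klMap_sub_mem cs φ hn)
      exact ⟨h - g, by rw [map_sub, hg]; abel⟩

/-- The Kazhdan–Lusztig basis `(C_w)`. -/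
noncomputable def klBasis : Module.Basis W (GroupRing Γ) (Hecke cs φ) :=
  (stdBasis cs φ).map (LinearEquiv.ofBijective (klMap cs φ) (klMap_bijective cs φ))

theorem klBasis_apply (w : W) : klBasis cs φ w = C cs φ w := by
  rw [klBasis, Module.Basis.map_apply]
  exact klMap_T cs φ w

/-! ### Preorders and cells -/

/-- The three kinds of cells: left, right and two-sided. -/
inductive Side
  | L
  | R
  | LR

/-- `x ←_{?} y`: there is `h` such that `C_x` has a non-zero coefficient in `h C_y` (for `L`), in
`C_y h` (for `R`), in `h C_y` or `C_y h` (for `LR`). -/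
def Arrow : Side → W → W → Prop
  | .L, x, y => ∃ h, (klBasis cs φ).repr (h * C cs φ y) x ≠ 0
  | .R, x, y => ∃ h, (klBasis cs φ).repr (C cs φ y * h) x ≠ 0
  | .LR, x, y => ∃ h, (klBasis cs φ).repr (h * C cs φ y) x ≠ 0 ∨
      (klBasis cs φ).repr (C cs φ y * h) x ≠ 0

/-- The preorder `≤_?`: the transitive closure of `←_?`. -/
def CellLE (d : Side) : W → W → Prop := Relation.TransGen (Arrow cs φ d)

/-- The equivalence relation `∼_?` associated with `≤_?`; its classes are the cells. -/
def CellEquiv (d : Side) (x y : W) : Prop := CellLE cs φ d x y ∧ CellLE cs φ d y x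

end KL

section Sign

variable {B W : Type*} [Group W] {M : CoxeterMatrix B} (cs : CoxeterSystem M W)
variable {Γ : Type*} [AddCommGroup Γ]

/-- The linear map `θ : H(W,S,φ) → H(W,S,φ')` with `θ(T_w) = (-1)^{ℓ_P(w)} T_w`, where `ℓ_P(w)` is
the number of letters in `P` of a reduced expression of `w`. -/
noncomputable def theta (P : Set B) (φ φ' : SimpleClass cs → Γ) :
    Hecke cs φ →ₗ[GroupRing Γ] Hecke cs φ' :=
  (stdBasis cs φ).constr (GroupRing Γ) fun w => (-1 : GroupRing Γ) ^ lengthIn cs P w • T cs φ' w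

end Sign

end KazhdanLusztig

/-!
A character `ε : W → {±1}` twists the Hecke algebra: if `φ' = ε φ` on simple reflections, then the
quadratic relations for `ε(s) T_s` with parameter `φ` are those for `T_s` with parameter `φ'`,
because `e^{-γ} - e^γ = -(e^γ - e^{-γ})`. Hence `T_w ↦ ε(w) T_w` is an isomorphism of algebras.
Being diagonal with entries `±1` in the standard bases, it preserves `H_{<0}`, and it sends the
inverse of `T_s` to `ε(s)` times the inverse of `T_s`, so it commutes with the bar involution.
Uniqueness of the Kazhdan–Lusztig elements then forces `C_w ↦ ε(w) C_w`, and multiplying structure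
constants by signs does not affect which of them vanish.

The sign `(-1)^{ℓ_-(w)}` is such a character: the assignment `s ↦ ±1` extends to `W` because two
simple reflections whose product has odd order are conjugate.
-/

theorem isConj_of_mul_pow_eq_one_of_odd {G : Type*} [Group G] {s t : G} (hs : s * s = 1)
    (ht : t * t = 1) {n : ℕ} (hn : Odd n) (h : (s * t) ^ n = 1) : IsConj s t := by
  obtain ⟨k, rfl⟩ := hn
  have hs' : s⁻¹ = s := inv_eq_of_mul_eq_one_left hs
  have ht' : t⁻¹ = t := inv_eq_of_mul_eq_one_left ht
  have hpow : (s * t) ^ (2 * k) = t * s := by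
    rw [pow_succ] at h
    rw [eq_inv_of_mul_eq_one_left h, mul_inv_rev, hs', ht']
  refine isConj_iff.2 ⟨(s * t) ^ k, ?_⟩
  calc (s * t) ^ k * s * ((s * t) ^ k)⁻¹
      = (s * t) ^ k * (s * (t * s) ^ k) := by
        rw [← inv_pow, mul_inv_rev, hs', ht', mul_assoc]
    _ = (s * t) ^ (2 * k) * s := by rw [← mul_pow_mul, two_mul, pow_add, mul_assoc]
    _ = t := by rw [hpow, mul_assoc, hs, mul_one]

theorem neg_one_pow_smul_eq_units_smul (R : Type*) {N : Type*} [Ring R] [AddCommGroup N]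
    [Module R N] (n : ℕ) (x : N) : (-1 : R) ^ n • x = (-1 : ℤˣ) ^ n • x := by
  rcases Nat.even_or_odd n with hn | hn <;> simp [hn.neg_one_pow]

theorem basis_repr_map_of_map_eq_units_smul {ι R N N' : Type*} [Ring R]
    [AddCommGroup N] [Module R N] [AddCommGroup N'] [Module R N'] (b : Module.Basis ι R N)
    (b' : Module.Basis ι R N') (f : N →ₗ[R] N') {c : ι → ℤˣ} (hf : ∀ i, f (b i) = c i • b' i)
    (x : N) (i : ι) : b'.repr (f x) i = c i • b.repr x i := by
  classical
  have hcoord : b'.coord i ∘ₗ f = c i • b.coord i := by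
    refine b.ext fun j => ?_
    rcases eq_or_ne j i with rfl | hji
    · simp [hf, Units.smul_def]
    · simp [hf, Units.smul_def, Finsupp.single_eq_of_ne' hji]
  exact LinearMap.congr_fun hcoord x

namespace KazhdanLusztig

section SignCharacter

variable {B W : Type*} [Group W] {M : CoxeterMatrix B} (cs : CoxeterSystem M W) {P : Set B}

open Classical in
theorem isLiftable_ite_mem
    (hP : ∀ i j, IsConj (cs.simple i) (cs.simple j) → (i ∈ P ↔ j ∈ P)) :
    M.IsLiftable fun i => if i ∈ P then (-1 : ℤˣ) else 1 := by
  intro i j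
  rcases Nat.even_or_odd (M i j) with ⟨k, hk⟩ | hodd
  · rw [hk, ← two_mul, pow_mul, Int.units_sq, one_pow]
  · have hconj : IsConj (cs.simple i) (cs.simple j) :=
      isConj_of_mul_pow_eq_one_of_odd (cs.simple_mul_simple_self i) (cs.simple_mul_simple_self j)
        hodd (cs.simple_mul_simple_pow i j)
    simp only [hP i j hconj, Int.units_mul_self, one_pow]

open Classical in
/-- The character of `W` with value `-1` on the simple reflections in `P` and `1` on the others,
where `P` is a union of conjugacy classes of simple reflections. -/
noncomputable def signCharacter
    (hP : ∀ i j, IsConj (cs.simple i) (cs.simple j) → (i ∈ P ↔ j ∈ P)) : W →* ℤˣ :=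
  cs.lift ⟨fun i => if i ∈ P then -1 else 1, isLiftable_ite_mem cs hP⟩

variable {cs} (hP : ∀ i j, IsConj (cs.simple i) (cs.simple j) → (i ∈ P ↔ j ∈ P))

open Classical in
theorem signCharacter_simple (i : B) :
    signCharacter cs hP (cs.simple i) = if i ∈ P then -1 else 1 :=
  cs.lift_apply_simple (isLiftable_ite_mem cs hP) i

open Classical in
theorem signCharacter_wordProd (ω : List B) :
    signCharacter cs hP (cs.wordProd ω) = (-1) ^ ω.countP (· ∈ P) := by
  induction ω with
  | nil => simp
  | cons i ω ih =>
    rw [cs.wordProd_cons, map_mul, ih, signCharacter_simple]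
    by_cases hi : i ∈ P <;> simp [hi, pow_succ]

theorem signCharacter_apply (w : W) : signCharacter cs hP w = (-1) ^ lengthIn cs P w := by
  rw [lengthIn, ← signCharacter_wordProd hP, wordProd_reducedWord]

theorem neg_one_pow_lengthIn_smul {R N : Type*} [Ring R] [AddCommGroup N] [Module R N] (w : W)
    (x : N) : (-1 : R) ^ lengthIn cs P w • x = signCharacter cs hP w • x := by
  rw [signCharacter_apply, neg_one_pow_smul_eq_units_smul]

end SignCharacter

section HeckeAlgebra

variable {Γ : Type*} [AddCommGroup Γ]

theorem expG_units_smul_sub_expG_neg (u : ℤˣ) (γ : Γ) :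
    expG (u • γ) - expG (-(u • γ)) = u • (expG γ - expG (-γ)) := by
  rcases Int.units_eq_one_or u with rfl | rfl <;> simp

variable {B W : Type*} [Group W] {M : CoxeterMatrix B} {cs : CoxeterSystem M W}
variable {φ : SimpleClass cs → Γ}

theorem bar_units_smul (u : ℤˣ) (h : Hecke cs φ) : bar cs φ (u • h) = u • bar cs φ h := by
  rcases Int.units_eq_one_or u with rfl | rfl <;> simp [bar_neg]

theorem bar_one : bar cs φ 1 = 1 := by
  rw [← T_one, bar_T, barT_one, T_one]

theorem T_simple_mul_T_eq_or (i : B) (w : W) :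
    T cs φ (cs.simple i) * T cs φ w = T cs φ (cs.simple i * w) ∨
      T cs φ (cs.simple i) * T cs φ w = T cs φ (cs.simple i * w) + xi cs φ i • T cs φ w := by
  rcases cs.length_simple_mul w i with hl | hl
  · exact .inl (T_simple_mul_of_lt cs φ (by omega))
  · exact .inr (T_simple_mul_of_gt cs φ (by omega))

theorem T_simple_mul_induction {p : Hecke cs φ → Prop} (one : p 1)
    (add : ∀ h h', p h → p h' → p (h + h')) (smul : ∀ (a : GroupRing Γ) h, p h → p (a • h))
    (T_simple_mul : ∀ i h, p h → p (T cs φ (cs.simple i) * h)) (h : Hecke cs φ) : p h := by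
  have p_T (w : W) : p (T cs φ w) := by
    induction w using cs.simple_induction_left with
    | one => exact one
    | mul_simple_left w i ih =>
      rcases T_simple_mul_T_eq_or (φ := φ) i w with hT | hT
      · exact hT ▸ T_simple_mul i _ ih
      · rw [eq_sub_of_add_eq hT.symm, sub_eq_add_neg, ← neg_smul]
        exact add _ _ (T_simple_mul i _ ih) (smul _ _ ih)
  induction h using hecke_induction with
  | zero => simpa using smul 0 1 one
  | add h h' ih ih' => exact add h h' ih ih'
  | smul a w => exact smul a _ (p_T w)

end HeckeAlgebra

section Twist

variable {B W : Type*} [Group W] {M : CoxeterMatrix B} {cs : CoxeterSystem M W}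
variable {Γ : Type*} [AddCommGroup Γ] (ε : W →* ℤˣ) (φ φ' : SimpleClass cs → Γ)

/-- The parameter `φ'` is the product of `φ` with the restriction of the character `ε` to the simple
reflections. -/
def IsTwist : Prop := ∀ i, φ' (simpleClass cs i) = ε (cs.simple i) • φ (simpleClass cs i)

/-- The linear map `T_w ↦ ε(w) T_w` from the Hecke algebra with parameter `φ` to the one with
parameter `φ'`, the twist by the character `ε`. -/
noncomputable def twist : Hecke cs φ →ₗ[GroupRing Γ] Hecke cs φ' :=
  (stdBasis cs φ).constr (GroupRing Γ) fun w => ε w • T cs φ' w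

theorem theta_eq_twist {P : Set B}
    (hP : ∀ i j, IsConj (cs.simple i) (cs.simple j) → (i ∈ P ↔ j ∈ P)) :
    theta cs P φ φ' = twist (signCharacter cs hP) φ φ' := by
  simp only [theta, twist, neg_one_pow_lengthIn_smul hP]

variable {ε φ φ'}

theorem isTwist_signCharacter {P : Set B}
    (hP : ∀ i j, IsConj (cs.simple i) (cs.simple j) → (i ∈ P ↔ j ∈ P))
    (h_mem : ∀ i ∈ P, φ' (simpleClass cs i) = -φ (simpleClass cs i))
    (h_notMem : ∀ i ∉ P, φ' (simpleClass cs i) = φ (simpleClass cs i)) :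
    IsTwist (signCharacter cs hP) φ φ' := fun i => by
  by_cases hi : i ∈ P
  · simp [signCharacter_simple, hi, h_mem]
  · simp [signCharacter_simple, hi, h_notMem]

theorem IsTwist.xi_eq (H : IsTwist ε φ φ') (i : B) :
    xi cs φ' i = ε (cs.simple i) • xi cs φ i := by
  rw [xi, xi, H i, expG_units_smul_sub_expG_neg]

theorem twist_T (w : W) : twist ε φ φ' (T cs φ w) = ε w • T cs φ' w :=
  Module.Basis.constr_basis _ _ _ _

theorem twist_one : twist ε φ φ' 1 = 1 := by
  rw [← T_one, twist_T, map_one, one_smul, T_one]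

theorem twist_comp_twist : twist ε φ' φ ∘ₗ twist ε φ φ' = LinearMap.id := by
  refine (stdBasis cs φ).ext fun w => ?_
  change twist ε φ' φ (twist ε φ φ' (T cs φ w)) = T cs φ w
  rw [twist_T, LinearMap.map_smul_of_tower, twist_T, smul_smul, Int.units_mul_self, one_smul]

theorem twist_twist (h : Hecke cs φ) : twist ε φ' φ (twist ε φ φ' h) = h := by
  rw [← LinearMap.comp_apply, twist_comp_twist, LinearMap.id_apply]

theorem IsTwist.twist_T_simple_mul (H : IsTwist ε φ φ') (i : B) (h : Hecke cs φ) :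
    twist ε φ φ' (T cs φ (cs.simple i) * h) =
      ε (cs.simple i) • (T cs φ' (cs.simple i) * twist ε φ φ' h) := by
  induction h using hecke_induction with
  | zero => simp
  | add x y hx hy => rw [mul_add, map_add, map_add, mul_add, smul_add, hx, hy]
  | smul a w =>
    rw [mul_smul_comm, map_smul, map_smul, mul_smul_comm, smul_comm _ a, twist_T, mul_smul_comm]
    congr 1
    rcases cs.length_simple_mul w i with hl | hl
    · rw [T_simple_mul_of_lt cs φ (by omega), T_simple_mul_of_lt cs φ' (by omega), twist_T,
        map_mul, mul_smul]
    · rw [T_simple_mul_of_gt cs φ (by omega), T_simple_mul_of_gt cs φ' (by omega), map_add,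
        map_smul, twist_T, twist_T, map_mul, smul_add, smul_add, mul_smul, H.xi_eq,
        smul_assoc (ε (cs.simple i)), smul_comm (ε w) (ε (cs.simple i)),
        smul_smul (ε (cs.simple i)) (ε (cs.simple i)), Int.units_mul_self, one_smul,
        smul_comm (ε w)]

theorem IsTwist.twist_mul (H : IsTwist ε φ φ') (h h' : Hecke cs φ) :
    twist ε φ φ' (h * h') = twist ε φ φ' h * twist ε φ φ' h' := by
  induction h using T_simple_mul_induction with
  | one => rw [twist_one, one_mul, one_mul]
  | add x y hx hy => rw [add_mul, map_add, map_add, add_mul, hx, hy]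
  | smul a x hx => rw [smul_mul_assoc, map_smul, map_smul, smul_mul_assoc, hx]
  | T_simple_mul i x hx =>
    rw [mul_assoc, H.twist_T_simple_mul, H.twist_T_simple_mul, hx, smul_mul_assoc, mul_assoc]

/-- The twist by a character as an isomorphism of algebras. -/
noncomputable def IsTwist.algEquiv (H : IsTwist ε φ φ') : Hecke cs φ ≃ₐ[GroupRing Γ] Hecke cs φ' :=
  .ofLinearEquiv (.ofLinearMap (twist ε φ φ') (twist ε φ' φ) twist_comp_twist twist_comp_twist)
    twist_one H.twist_mul

theorem IsTwist.algEquiv_apply (H : IsTwist ε φ φ') (h : Hecke cs φ) :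
    H.algEquiv h = twist ε φ φ' h := rfl

theorem IsTwist.twist_TsInv (H : IsTwist ε φ φ') (i : B) :
    twist ε φ φ' (TsInv cs φ i) = ε (cs.simple i) • TsInv cs φ' i := by
  rw [TsInv, TsInv, map_sub, map_smul, twist_one, twist_T, H.xi_eq, smul_sub,
    smul_assoc (ε (cs.simple i)), smul_smul, Int.units_mul_self, one_smul]

theorem IsTwist.twist_bar (H : IsTwist ε φ φ') (h : Hecke cs φ) :
    twist ε φ φ' (bar cs φ h) = bar cs φ' (twist ε φ φ' h) := by
  induction h using T_simple_mul_induction with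
  | one => rw [bar_one, twist_one, bar_one]
  | add x y hx hy => rw [bar_add, map_add, map_add, bar_add, hx, hy]
  | smul a x hx => rw [bar_smul, map_smul, map_smul, bar_smul, hx]
  | T_simple_mul i x hx =>
    rw [bar_T_simple_mul, H.twist_mul, H.twist_TsInv, hx, H.twist_T_simple_mul, bar_units_smul,
      bar_T_simple_mul, smul_mul_assoc]

theorem stdBasis_repr_twist (h : Hecke cs φ) (w : W) :
    (stdBasis cs φ').repr (twist ε φ φ' h) w = ε w • (stdBasis cs φ).repr h w :=
  basis_repr_map_of_map_eq_units_smul _ _ _ twist_T h w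

end Twist

section KazhdanLusztigBasis

variable {B W : Type*} [Group W] {M : CoxeterMatrix B} {cs : CoxeterSystem M W}
variable {Γ : Type*} [AddCommGroup Γ] [LinearOrder Γ]
variable {ε : W →* ℤˣ} {φ φ' : SimpleClass cs → Γ}

theorem twist_mem_heckeNeg {h : Hecke cs φ} (hh : h ∈ heckeNeg cs φ) :
    twist ε φ φ' h ∈ heckeNeg cs φ' := fun w => by
  rw [stdBasis_repr_twist, Units.smul_def]
  exact zsmul_mem (hh w) _

theorem image_twist_heckeNeg :
    twist ε φ φ' '' (heckeNeg cs φ : Set _) = (heckeNeg cs φ' : Set _) := by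
  ext h
  constructor
  · rintro ⟨g, hg, rfl⟩
    exact twist_mem_heckeNeg hg
  · intro hh
    exact ⟨twist ε φ' φ h, twist_mem_heckeNeg hh, twist_twist h⟩

theorem IsTwist.isKLElement_smul_twist (H : IsTwist ε φ φ') {w : W} {c : Hecke cs φ}
    (hc : IsKLElement cs φ w c) : IsKLElement cs φ' w (ε w • twist ε φ φ' c) := by
  constructor
  · rw [bar_units_smul, ← H.twist_bar, hc.1]
  · have hT : ε w • twist ε φ φ' c - T cs φ' w = ε w • twist ε φ φ' (c - T cs φ w) := by
      rw [map_sub, smul_sub, twist_T, smul_smul, Int.units_mul_self, one_smul]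
    rw [hT, Units.smul_def]
    exact zsmul_mem (twist_mem_heckeNeg hc.2) _

variable [IsOrderedAddMonoid Γ]

theorem IsTwist.twist_C (H : IsTwist ε φ φ') (w : W) :
    twist ε φ φ' (C cs φ w) = ε w • C cs φ' w := by
  rw [← isKLElement_unique cs φ' (H.isKLElement_smul_twist (isKLElement_C cs φ w))
    (isKLElement_C cs φ' w), smul_smul, Int.units_mul_self, one_smul]

theorem IsTwist.klBasis_repr_twist (H : IsTwist ε φ φ') (h : Hecke cs φ) (x : W) :
    (klBasis cs φ').repr (twist ε φ φ' h) x = ε x • (klBasis cs φ).repr h x :=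
  basis_repr_map_of_map_eq_units_smul _ _ _
    (fun w => by rw [klBasis_apply, klBasis_apply, H.twist_C]) h x

theorem IsTwist.klBasis_repr_twist_mul_C_ne_zero_iff (H : IsTwist ε φ φ') (h : Hecke cs φ)
    (x y : W) : (klBasis cs φ').repr (twist ε φ φ' h * C cs φ' y) x ≠ 0 ↔
      (klBasis cs φ).repr (h * C cs φ y) x ≠ 0 := by
  have hcoeff : ε y • (klBasis cs φ').repr (twist ε φ φ' h * C cs φ' y) x =
      ε x • (klBasis cs φ).repr (h * C cs φ y) x := by
    rw [← H.klBasis_repr_twist, H.twist_mul, H.twist_C, mul_smul_comm]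
    simp only [Units.smul_def, map_zsmul, Finsupp.smul_apply]
  rw [← smul_ne_zero_iff_ne (ε y), hcoeff, smul_ne_zero_iff_ne]

theorem IsTwist.klBasis_repr_C_mul_twist_ne_zero_iff (H : IsTwist ε φ φ') (h : Hecke cs φ)
    (x y : W) : (klBasis cs φ').repr (C cs φ' y * twist ε φ φ' h) x ≠ 0 ↔
      (klBasis cs φ).repr (C cs φ y * h) x ≠ 0 := by
  have hcoeff : ε y • (klBasis cs φ').repr (C cs φ' y * twist ε φ φ' h) x =
      ε x • (klBasis cs φ).repr (C cs φ y * h) x := by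
    rw [← H.klBasis_repr_twist, H.twist_mul, H.twist_C, smul_mul_assoc]
    simp only [Units.smul_def, map_zsmul, Finsupp.smul_apply]
  rw [← smul_ne_zero_iff_ne (ε y), hcoeff, smul_ne_zero_iff_ne]

theorem IsTwist.arrow_iff (H : IsTwist ε φ φ') (d : Side) (x y : W) :
    Arrow cs φ d x y ↔ Arrow cs φ' d x y := by
  cases d <;>
    simp only [Arrow, H.algEquiv.surjective.exists, H.algEquiv_apply,
      H.klBasis_repr_twist_mul_C_ne_zero_iff, H.klBasis_repr_C_mul_twist_ne_zero_iff]

theorem IsTwist.cellLE_eq (H : IsTwist ε φ φ') (d : Side) : CellLE cs φ d = CellLE cs φ' d :=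
  congrArg Relation.TransGen (funext₂ fun x y => propext (H.arrow_iff d x y))

theorem IsTwist.cellEquiv_eq (H : IsTwist ε φ φ') (d : Side) :
    CellEquiv cs φ d = CellEquiv cs φ' d := by
  funext x y
  rw [CellEquiv, CellEquiv, H.cellLE_eq]

end KazhdanLusztigBasis

end KazhdanLusztig

theorem mainTheorem5 {B W Γ : Type*} [Group W] {M : CoxeterMatrix B} (cs : CoxeterSystem M W)
    [AddCommGroup Γ] [LinearOrder Γ] [IsOrderedAddMonoid Γ]
    (Splus Sminus : Set B) (hpart : IsCompl Splus Sminus)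
    (hconj : ∀ i ∈ Splus, ∀ j ∈ Sminus, ¬ IsConj (cs.simple i) (cs.simple j))
    (φ φ' : KazhdanLusztig.SimpleClass cs → Γ)
    (hplus : ∀ i ∈ Splus,
      φ' (KazhdanLusztig.simpleClass cs i) = φ (KazhdanLusztig.simpleClass cs i))
    (hminus : ∀ i ∈ Sminus,
      φ' (KazhdanLusztig.simpleClass cs i) = -φ (KazhdanLusztig.simpleClass cs i)) :
    (∃ e : KazhdanLusztig.Hecke cs φ ≃ₐ[KazhdanLusztig.GroupRing Γ] KazhdanLusztig.Hecke cs φ',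
      ∀ h, e h = KazhdanLusztig.theta cs Sminus φ φ' h) ∧
    KazhdanLusztig.theta cs Sminus φ φ' '' (KazhdanLusztig.heckeNeg cs φ : Set _) =
      (KazhdanLusztig.heckeNeg cs φ' : Set _) ∧
    (∀ h : KazhdanLusztig.Hecke cs φ,
      KazhdanLusztig.theta cs Sminus φ φ' (KazhdanLusztig.bar cs φ h) =
        KazhdanLusztig.bar cs φ' (KazhdanLusztig.theta cs Sminus φ φ' h)) ∧
    (∀ w : W, KazhdanLusztig.theta cs Sminus φ φ' (KazhdanLusztig.C cs φ w) =
      (-1 : KazhdanLusztig.GroupRing Γ) ^ KazhdanLusztig.lengthIn cs Sminus w •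
        KazhdanLusztig.C cs φ' w) ∧
    (∀ (d : KazhdanLusztig.Side) (x y : W),
      (KazhdanLusztig.CellLE cs φ d x y ↔ KazhdanLusztig.CellLE cs φ' d x y) ∧
      (KazhdanLusztig.CellEquiv cs φ d x y ↔ KazhdanLusztig.CellEquiv cs φ' d x y)) := by
  obtain rfl := hpart.compl_eq
  have hP (i j : B) (hij : IsConj (cs.simple i) (cs.simple j)) : i ∈ Splusᶜ ↔ j ∈ Splusᶜ :=
    not_congr ⟨fun hi => by_contra fun hj => hconj i hi j hj hij,
      fun hj => by_contra fun hi => hconj j hj i hi hij.symm⟩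
  have H : KazhdanLusztig.IsTwist (KazhdanLusztig.signCharacter cs hP) φ φ' :=
    KazhdanLusztig.isTwist_signCharacter hP hminus fun i hi => hplus i (not_not.1 hi)
  simp only [KazhdanLusztig.theta_eq_twist φ φ' hP,
    KazhdanLusztig.neg_one_pow_lengthIn_smul hP]
  exact ⟨⟨H.algEquiv, H.algEquiv_apply⟩, KazhdanLusztig.image_twist_heckeNeg, H.twist_bar,
    H.twist_C, fun d x y => ⟨by rw [H.cellLE_eq], by rw [H.cellEquiv_eq]⟩⟩
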